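/- Let $d\ge 2$, $N\ge 1$, let $H$ be a Hermitian $d\times d$ matrix, let $S:\mathcal X\to\mathcal U(d)$ be any map into the unitary group, and consider the ensemble model $$f(x)=\frac{\sqrt d}{\sqrt N}\sum_{n=1}^N a_n\,\langle 0|U_n^\dagger S(x)^\dagger W_n^\dagger H W_n S(x)U_n|0\rangle ,\qquad a\in\mathbb R^N,\ U_n,W_n\in\mathcal U(d),$$ where $|0\rangle$ is the first vector of the computational basis of $\mathbb C^d$. Its tangent kernel is $K(x,x')=\nabla_a f(x)^{T}\,\nabla_a f(x')$. Let $U_1,\dots,U_N,W_1,\dots,W_N$ be independent and distributed according to the normalized Haar measure on $\mathcal U(d)$, and put $s=|\mathrm{Tr}(S(x')S(x)^\dagger)|^2$. (1) For every $a\in\mathbb R^N$ and all $x,x'\in\mathcal X$, the kernel $K(x,x')$ is integrable and $$\mathbb E\,K(x,x')=\frac{d^3+d^2-d-s}{d(d^3+d^2-d-1)}\,\mathrm{Tr}(H)^2+\frac{s-1}{d^3+d^2-d-1}\,\mathrm{Tr}(H^2).$$ (2) If $\mathrm{Tr}(H)=0$ and $\mathrm{Tr}(H^2)=d$, then $$\mathbb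 E\,K(x,x')=\frac{d(s-1)}{d^3+d^2-d-1}.$$ (3) Every Pauli string $H=P_1\otimes\cdots\otimes P_n$ with $P_k\in\{I,X,Y,Z\}$, not all equal to $I$, is Hermitian with $\mathrm{Tr}(H)=0$ and $\mathrm{Tr}(H^2)=2^n=d$. (4) Consider a sequence of such models, with dimensions $d_m\to\infty$, sizes $N_m\ge1$, observables $H_m$ with $\mathrm{Tr}(H_m)=0$ and $\mathrm{Tr}(H_m^2)=d_m$, encodings $S_m$, parameters $a_m$ and points $x_m,x_m'$, and let $s_m$ and $\mathbb E K_m$ be the corresponding values of $s$ and $\mathbb E K(x,x')$. If $s_m\sim d_m^2$, then $\mathbb E K_m\to1$; if $s_m=o(d_m^2)$, then $\mathbb E K_m\to0$. More generally, for every real $c$, $\mathbb E K_m\to c$ if and only if $s_m/d_m^2\to c$. -/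

import Mathlib

open MeasureTheory Filter Topology Asymptotics

noncomputable section

namespace QuantumEnsemble

/-- The unitary group `𝒰(d)`, as matrices in the computational basis. -/
abbrev UnitaryGrp (d : ℕ) : Type := ↥(Matrix.unitaryGroup (Fin d) ℂ)

/-- The unitary group is compact (with the topology inherited from the space of matrices). -/
instance compactSpace_unitaryGrp (d : ℕ) : CompactSpace (UnitaryGrp d) := by
  have hK : IsCompact (Set.univ.pi fun _ : Fin d => Set.univ.pi fun _ : Fin d =>
      Metric.closedBall (0 : ℂ) 1) :=
    isCompact_univ_pi fun _ => isCompact_univ_pi fun _ => isCompact_closedBall _ _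
  refine (isCompact_iff_compactSpace
    (s := ((Matrix.unitaryGroup (Fin d) ℂ : Submonoid (Matrix (Fin d) (Fin d) ℂ)) :
      Set (Matrix (Fin d) (Fin d) ℂ)))).mp (hK.of_isClosed_subset ?_ ?_)
  · have h : ((Matrix.unitaryGroup (Fin d) ℂ : Submonoid (Matrix (Fin d) (Fin d) ℂ)) :
        Set (Matrix (Fin d) (Fin d) ℂ)) = {A | A * star A = 1} := by
      ext A
      exact Matrix.mem_unitaryGroup_iff
    have hc : IsClosed {A : Matrix (Fin d) (Fin d) ℂ | A * star A = 1} :=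
      isClosed_eq (continuous_id.matrix_mul continuous_id.matrix_conjTranspose) continuous_const
    rw [← h] at hc
    exact hc
  · intro A hA i _ j _
    simpa using entry_norm_bound_of_unitary hA i j

instance measurableSpace_unitaryGrp (d : ℕ) : MeasurableSpace (UnitaryGrp d) := borel _

instance borelSpace_unitaryGrp (d : ℕ) : BorelSpace (UnitaryGrp d) := ⟨rfl⟩

/-- The Haar measure on `𝒰(d)`, normalized to total mass `1`. -/
def haarUnitary (d : ℕ) : Measure (UnitaryGrp d) := Measure.haarMeasure ⊤

instance isProbabilityMeasure_haarUnitary (d : ℕ) : IsProbabilityMeasure (haarUnitary d) :=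
  ⟨Measure.haarMeasure_self⟩

/-- The reference state `|0⟩`, the first vector of the computational basis of `ℂ^d`. -/
def ket0 (d : ℕ) [NeZero d] : Fin d → ℂ := Pi.single 0 1

/-- The state `W S U |0⟩`. -/
def state {d : ℕ} [NeZero d] (U S W : UnitaryGrp d) : Fin d → ℂ :=
  ((W : Matrix (Fin d) (Fin d) ℂ) * (S : Matrix (Fin d) (Fin d) ℂ) *
    (U : Matrix (Fin d) (Fin d) ℂ)).mulVec (ket0 d)

/-- The expectation `⟨ψ|H|ψ⟩` of an observable `H` (a real number when `H` is Hermitian). -/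
def expectation {d : ℕ} (H : Matrix (Fin d) (Fin d) ℂ) (ψ : Fin d → ℂ) : ℝ :=
  (dotProduct (star ψ) (H.mulVec ψ)).re

/-- The ensemble model
`f(x) = (√d / √N) ∑ₙ aₙ ⟨0| Uₙ† S(x)† Wₙ† H Wₙ S(x) Uₙ |0⟩` with parameters `a ∈ ℝ^N`. -/
def ensembleModel {d : ℕ} [NeZero d] {N : ℕ} {X : Type*} (H : Matrix (Fin d) (Fin d) ℂ)
    (S : X → UnitaryGrp d) (U W : Fin N → UnitaryGrp d)
    (a : EuclideanSpace ℝ (Fin N)) (x : X) : ℝ :=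
  Real.sqrt d / Real.sqrt N * ∑ n, a n * expectation H (state (U n) (S x) (W n))

/-- The tangent kernel `K(x, x') = ∇f(x)ᵀ ∇f(x')` of a parametrized model at the parameter `θ`,
where the gradients are taken with respect to the parameter. -/
def tangentKernel {N : ℕ} {X : Type*} (f : EuclideanSpace ℝ (Fin N) → X → ℝ)
    (θ : EuclideanSpace ℝ (Fin N)) (x x' : X) : ℝ :=
  inner ℝ (gradient (fun t => f t x) θ) (gradient (fun t => f t x') θ)

/-- The tangent kernel of the ensemble model at the parameter `a`, as a function of the sampled
unitaries `ω = ((Uₙ)ₙ, (Wₙ)ₙ)`. -/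
def ensembleKernel {d : ℕ} [NeZero d] {N : ℕ} {X : Type*} (H : Matrix (Fin d) (Fin d) ℂ)
    (S : X → UnitaryGrp d) (a : EuclideanSpace ℝ (Fin N)) (x x' : X)
    (ω : (Fin N → UnitaryGrp d) × (Fin N → UnitaryGrp d)) : ℝ :=
  tangentKernel (ensembleModel H S ω.1 ω.2) a x x'

/-- The joint law of the unitaries `U₁, …, U_N, W₁, …, W_N`, sampled independently from the
Haar measure. -/
def samplingLaw (d N : ℕ) : Measure ((Fin N → UnitaryGrp d) × (Fin N → UnitaryGrp d)) :=
  (Measure.pi fun _ => haarUnitary d).prod (Measure.pi fun _ => haarUnitary d)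

/-- The expected tangent kernel `𝔼 K(x, x')` of the ensemble model. -/
def expectedKernel {d : ℕ} [NeZero d] {N : ℕ} {X : Type*} (H : Matrix (Fin d) (Fin d) ℂ)
    (S : X → UnitaryGrp d) (a : EuclideanSpace ℝ (Fin N)) (x x' : X) : ℝ :=
  ∫ ω, ensembleKernel H S a x x' ω ∂(samplingLaw d N)

/-- The overlap `s = |Tr(S(x') S(x)†)|²` of two encoding unitaries. -/
def overlap {d : ℕ} {X : Type*} (S : X → UnitaryGrp d) (x x' : X) : ℝ :=
  ‖((S x' : Matrix (Fin d) (Fin d) ℂ) *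
    (S x : Matrix (Fin d) (Fin d) ℂ).conjTranspose).trace‖ ^ 2

/-- Labels of the single-qubit Pauli matrices. -/
inductive Pauli
  | I
  | X
  | Y
  | Z

/-- The single-qubit Pauli matrices, including the identity. -/
def Pauli.matrix : Pauli → Matrix (Fin 2) (Fin 2) ℂ
  | .I => !![1, 0; 0, 1]
  | .X => !![0, 1; 1, 0]
  | .Y => !![0, -Complex.I; Complex.I, 0]
  | .Z => !![1, 0; 0, -1]

/-- The tensor product `P₁ ⊗ ⋯ ⊗ Pₙ` of Pauli matrices on `n` qubits, in the computational basis
of `ℂ^(2^n)`, whose elements are labelled by the binary digits of their index. -/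
def pauliString {n : ℕ} (P : Fin n → Pauli) : Matrix (Fin (2 ^ n)) (Fin (2 ^ n)) ℂ :=
  Matrix.of fun i j =>
    ∏ k, (P k).matrix (finFunctionFinEquiv.symm i k) (finFunctionFinEquiv.symm j k)

end QuantumEnsemble

end

/-!
The model is linear in `a`, so its tangent kernel is `d / N` times a sum over the `N` members of
products `⟨ψ|H|ψ⟩ ⟨ψ'|H|ψ'⟩` with `ψ = W S(x) U|0⟩` and `ψ' = W S(x') U|0⟩`. All members contribute
the same expectation, which is a second moment in `U` and in `W`
(`expectedKernel_eq_integral_memberKernel`).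

Second moments `𝔼 Mᵢⱼ Mₖₗ` of a random matrix whose law is invariant under unitary conjugation form
a tensor invariant under that conjugation. Such a tensor is `α δᵢⱼ δₖₗ + β δᵢₗ δₖⱼ`
(`IsUnitaryInvariant.exists_eq`): diagonal unitaries annihilate all other entries, permutations
show that the entries of each kind agree, and a square root of a transposition yields
`Gᵢᵢᵢᵢ = α + β`. Contracting indices expresses `α` and `β` through `Tr M` and `Tr M²`, here
constants (`integral_mul_entries`). This short case of Weingarten calculus applies twice:

* to `M = U|0⟩⟨0|U†`, giving `𝔼 Tr(M A) Tr(M B) = (Tr A Tr B + Tr(A B)) / (d (d + 1))` with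
  `A = S(x)† W† H W S(x)` and `B = S(x')† W† H W S(x')`, whose traces are `Tr H`;
* to `M = W† H W`, giving `𝔼 Tr(A B) = 𝔼 Tr(M T M T†) = α d + β |Tr T|²` with `T = S(x) S(x')†`.

Together these are `integral_memberKernel`, from which `expectedKernel_formula` is algebra. For a
Pauli string the traces factor over the qubits. In the limit, the kernel is
`u(d) · s / d² - v(d)` with `u → 1` and `v → 0`, so that it converges exactly when `s / d²` does.
-/

namespace QuantumEnsemble

/-! ### Tensors invariant under unitary conjugation -/

section InvariantTensors

variable {n : Type*} [Fintype n] [DecidableEq n]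

/-- The entries of a tensor with two index pairs `(i, j)` and `(k, l)` are unchanged when both
pairs are conjugated by the same unitary matrix. -/
def IsUnitaryInvariant (G : n → n → n → n → ℂ) : Prop :=
  ∀ V ∈ Matrix.unitaryGroup n ℂ, ∀ i j k l,
    ∑ a, ∑ b, ∑ c, ∑ e, star (V a i) * V b j * (star (V c k) * V e l) * G a b c e = G i j k l

/-- Invariance under a diagonal unitary matrix. -/
lemma IsUnitaryInvariant.phase {G : n → n → n → n → ℂ} (hG : IsUnitaryInvariant G)
    (v : n → ℂ) (hv : ∀ a, v a * star (v a) = 1) (i j k l : n) :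
    star (v i) * v j * (star (v k) * v l) * G i j k l = G i j k l := by
  have h := hG (Matrix.diagonal v) (by
    rw [Matrix.mem_unitaryGroup_iff, Matrix.star_eq_conjTranspose, Matrix.diagonal_conjTranspose,
      Matrix.diagonal_mul_diagonal, ← Matrix.diagonal_one]
    congr 1
    ext a
    exact hv a) i j k l
  simpa [Matrix.diagonal_apply, apply_ite star, Finset.sum_ite_eq, mul_ite, ite_mul] using h

lemma permMatrix_mem_unitaryGroup (σ : Equiv.Perm n) :
    σ.permMatrix ℂ ∈ Matrix.unitaryGroup n ℂ := by
  rw [Matrix.mem_unitaryGroup_iff, Matrix.star_eq_conjTranspose, Matrix.conjTranspose_permMatrix,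
    ← Matrix.permMatrix_mul]
  simp

lemma IsUnitaryInvariant.perm {G : n → n → n → n → ℂ} (hG : IsUnitaryInvariant G)
    (σ : Equiv.Perm n) (i j k l : n) : G (σ i) (σ j) (σ k) (σ l) = G i j k l := by
  have h := hG _ (permMatrix_mem_unitaryGroup σ⁻¹) i j k l
  rw [← h]
  simp [Equiv.Perm.permMatrix, PEquiv.toMatrix_apply, Equiv.symm_apply_eq, Equiv.Perm.inv_def,
    apply_ite star, ite_mul]

/-- A diagonal entry is the sum of the two kinds of off-diagonal entries. This follows from
invariance under a square root of the transposition of `p` and `q`. -/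
lemma IsUnitaryInvariant.diag {G : n → n → n → n → ℂ} (hG : IsUnitaryInvariant G)
    (h0 : ∀ i j k l, G i j k l ≠ 0 → (i = j ∧ k = l) ∨ (i = l ∧ k = j))
    {p q : n} (hpq : p ≠ q) : G p p p p = G p p q q + G p q q p := by
  -- the square root of the swap is `(1 + i)/2 + (1 - i)/2 * swap`
  set z : ℂ := (1 + Complex.I) / 2 with hz
  set w : ℂ := (1 - Complex.I) / 2 with hw
  have hzs : star z = w := by simp [hz, hw, sub_eq_add_neg]
  have hws : star w = z := by simp [hz, hw, sub_eq_add_neg]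
  have hzw : z * w = 1 / 2 := by
    rw [hz, hw]; linear_combination (-1 / 4 : ℂ) * Complex.I_sq
  have hzz : z * z + w * w = 0 := by
    rw [hz, hw]; linear_combination (1 / 2 : ℂ) * Complex.I_sq
  set P : Matrix n n ℂ := (Equiv.swap p q).permMatrix ℂ with hP
  have hPP : P * P = 1 := by
    rw [hP, ← Matrix.permMatrix_mul]; simp
  have hPs : star P = P := by
    rw [hP, Matrix.star_eq_conjTranspose, Matrix.conjTranspose_permMatrix, Equiv.swap_inv]
  have h := hG (z • 1 + w • P) (by
    rw [Matrix.mem_unitaryGroup_iff, star_add, star_smul, star_smul, star_one, hPs, hzs, hws]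
    simp only [add_mul, mul_add, Matrix.smul_mul, Matrix.mul_smul, Matrix.one_mul, Matrix.mul_one,
      hPP, smul_smul]
    have : (w * z) • (1 : Matrix n n ℂ) + (w * w) • P + ((z * z) • P + (z * w) • 1)
        = (2 * (z * w)) • (1 : Matrix n n ℂ) + (z * z + w * w) • P := by
      module
    rw [this, hzw, hzz]
    simp) p p p p
  have hcol : ∀ a, (z • (1 : Matrix n n ℂ) + w • P) a p
      = z * (if a = p then 1 else 0) + w * (if a = q then 1 else 0) := by
    intro a
    simp [hP, Equiv.Perm.permMatrix, PEquiv.toMatrix_apply, Matrix.one_apply,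
      Equiv.swap_apply_eq_iff]
  have vanish : ∀ i j k l, ¬((i = j ∧ k = l) ∨ (i = l ∧ k = j)) → G i j k l = 0 :=
    fun i j k l hn => by_contra fun h => hn (h0 i j k l h)
  simp only [hcol, star_add, apply_ite star, star_zero, hzs, hws, mul_ite,
    mul_one, mul_zero, add_mul, mul_add, ite_mul, zero_mul, Finset.sum_add_distrib,
    Finset.sum_ite_eq', Finset.mem_univ, if_true] at h
  -- of the sixteen entries with indices in `{p, q}`, ten are not paired
  rw [vanish p p p q (by grind), vanish p p q p (by grind), vanish p q p p (by grind),
    vanish q p p p (by grind), vanish q q q p (by grind), vanish q q p q (by grind),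
    vanish q p q q (by grind), vanish p q q q (by grind), vanish p q p q (by grind),
    vanish q p q p (by grind)] at h
  have e1 : G q q q q = G p p p p := by simpa using hG.perm (Equiv.swap p q) p p p p
  have e2 : G q q p p = G p p q q := by simpa using hG.perm (Equiv.swap p q) p p q q
  have e3 : G q p p q = G p q q p := by simpa using hG.perm (Equiv.swap p q) p q q p
  rw [e1, e2, e3] at h
  have hzw2 : z * z * (w * w) = 1 / 4 := by
    linear_combination (z * w + 1 / 2) * hzw
  linear_combination (-2) * h + (4 * G p p p p + 4 * G p p q q + 4 * G p q q p) * hzw2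

lemma exists_perm_pair {m : Type*} [DecidableEq m] {p q i k : m} (hpq : p ≠ q) (hik : i ≠ k) :
    ∃ σ : Equiv.Perm m, σ p = i ∧ σ q = k := by
  refine ⟨Equiv.swap (Equiv.swap p i q) k * Equiv.swap p i, ?_, by simp⟩
  have h : i ≠ Equiv.swap p i q := by
    intro h
    rw [← Equiv.swap_apply_left p i] at h
    exact hpq ((Equiv.swap p i).injective (by simpa using h))
  simp [Equiv.swap_apply_of_ne_of_ne h hik]

/-- Invariance under diagonal unitaries leaves only the entries in which the first and third
index form the same pair as the second and fourth. -/
lemma IsUnitaryInvariant.support {G : n → n → n → n → ℂ} (hG : IsUnitaryInvariant G)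
    (i j k l : n) (h : G i j k l ≠ 0) : (i = j ∧ k = l) ∨ (i = l ∧ k = j) := by
  have key : ∀ p, ∀ v : n → ℂ, v = (fun a => if a = p then Complex.I else 1) →
      star (v i) * v j * (star (v k) * v l) = 1 := by
    rintro p v rfl
    have := hG.phase (fun a => if a = p then Complex.I else 1) (by
      intro a; split_ifs <;> simp) i j k l
    exact mul_right_cancel₀ h (by rw [one_mul]; exact this)
  have hI : (Complex.I : ℂ) ≠ 1 := by simp [Complex.ext_iff]
  have hI' : (-Complex.I : ℂ) ≠ 1 := by simp [Complex.ext_iff]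
  have hm : (-1 : ℂ) ≠ 1 := by norm_num
  -- the phase `i` at each of the three indices in turn already forces the pairing
  have h1 := key i _ rfl
  have h2 := key j _ rfl
  have h3 := key k _ rfl
  by_cases hij : i = j
  · subst hij
    refine Or.inl ⟨rfl, ?_⟩
    by_contra hkl
    rcases eq_or_ne i k with rfl | hik
    · simp [Ne.symm hkl, hI'] at h3
    · simp [Ne.symm hkl, hik, hI'] at h3
  · have hil : l = i := by
      by_contra hil
      rcases eq_or_ne k i with rfl | hik
      · simp [Ne.symm hij, hil, hm] at h1
      · simp [Ne.symm hij, hil, hik, hI'] at h1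
    subst hil
    refine Or.inr ⟨rfl, ?_⟩
    by_contra hkj
    simp [hij, hkj, hI] at h2

/-- The invariant tensors, that is the commutant of all `V ⊗ V` with `V` unitary, are spanned by the
identity and the flip. -/
theorem IsUnitaryInvariant.exists_eq [Nontrivial n] {G : n → n → n → n → ℂ}
    (hG : IsUnitaryInvariant G) : ∃ α β : ℂ, ∀ i j k l,
      G i j k l = α * (if i = j ∧ k = l then 1 else 0) + β * (if i = l ∧ k = j then 1 else 0) := by
  obtain ⟨p, q, hpq⟩ := exists_pair_ne n
  refine ⟨G p p q q, G p q q p, fun i j k l => ?_⟩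
  have off1 : ∀ i k, i ≠ k → G i i k k = G p p q q := fun i k hik => by
    obtain ⟨σ, rfl, rfl⟩ := exists_perm_pair hpq hik
    exact hG.perm σ _ _ _ _
  have off2 : ∀ i k, i ≠ k → G i k k i = G p q q p := fun i k hik => by
    obtain ⟨σ, rfl, rfl⟩ := exists_perm_pair hpq hik
    exact hG.perm σ _ _ _ _
  have on : ∀ i, G i i i i = G p p q q + G p q q p := fun i => by
    rw [← hG.diag hG.support hpq]
    simpa using hG.perm (Equiv.swap p i) p p p p
  by_cases h1 : i = j ∧ k = l
  · obtain ⟨rfl, rfl⟩ := h1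
    by_cases h : i = k
    · subst h; simp [on]
    · simp [off1 i k h, h]
  · by_cases h2 : i = l ∧ k = j
    · obtain ⟨rfl, rfl⟩ := h2
      have h : i ≠ k := fun h => h1 ⟨h, h.symm⟩
      simp [off2 i k h, h]
    · rw [if_neg h1, if_neg h2]
      by_contra h
      exact (hG.support i j k l (by simpa using h)).elim h1 h2

end InvariantTensors

/-! ### Second moments of unitarily invariant random matrices -/

section SecondMoments

/-- The coefficient of `δᵢⱼ δₖₗ` in the second moments of a unitarily invariant random
`d × d` matrix with trace `t₁` whose square has trace `t₂`. -/
noncomputable def identityCoeff (d : ℕ) (t₁ t₂ : ℂ) : ℂ :=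
  (d * t₁ ^ 2 - t₂) / (d * ((d : ℂ) ^ 2 - 1))

/-- The coefficient of `δᵢₗ δₖⱼ` in the second moments of a unitarily invariant random
`d × d` matrix with trace `t₁` whose square has trace `t₂`. -/
noncomputable def flipCoeff (d : ℕ) (t₁ t₂ : ℂ) : ℂ :=
  (d * t₂ - t₁ ^ 2) / (d * ((d : ℂ) ^ 2 - 1))

lemma conj_apply {d : ℕ} (V M : Matrix (Fin d) (Fin d) ℂ) (i j : Fin d) :
    (star V * M * V) i j = ∑ a, ∑ b, star (V a i) * M a b * V b j := by
  simp only [Matrix.mul_apply, Matrix.star_apply, Finset.sum_mul]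
  exact Finset.sum_comm

variable {d : ℕ} {Ω : Type*} [MeasurableSpace Ω] {μ : Measure Ω}
  {M : Ω → Matrix (Fin d) (Fin d) ℂ}

lemma integral_sum₄ {f : Fin d → Fin d → Fin d → Fin d → Ω → ℂ}
    (hf : ∀ a b c e, Integrable (f a b c e) μ) :
    ∫ ω, ∑ a, ∑ b, ∑ c, ∑ e, f a b c e ω ∂μ = ∑ a, ∑ b, ∑ c, ∑ e, ∫ ω, f a b c e ω ∂μ := by
  rw [integral_finsetSum _ fun a _ => integrable_finsetSum _ fun b _ =>
    integrable_finsetSum _ fun c _ => integrable_finsetSum _ fun e _ => hf a b c e]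
  refine Finset.sum_congr rfl fun a _ => ?_
  rw [integral_finsetSum _ fun b _ =>
    integrable_finsetSum _ fun c _ => integrable_finsetSum _ fun e _ => hf a b c e]
  refine Finset.sum_congr rfl fun b _ => ?_
  rw [integral_finsetSum _ fun c _ => integrable_finsetSum _ fun e _ => hf a b c e]
  exact Finset.sum_congr rfl fun c _ => integral_finsetSum _ fun e _ => hf a b c e

/-- Second moments inherit unitary invariance from the law of the random matrix. -/
lemma isUnitaryInvariant_secondMoment
    (hint : ∀ i j k l, Integrable (fun ω => M ω i j * M ω k l) μ)
    (hinv : ∀ V ∈ Matrix.unitaryGroup (Fin d) ℂ, ∀ i j k l,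
      ∫ ω, (star V * M ω * V) i j * (star V * M ω * V) k l ∂μ = ∫ ω, M ω i j * M ω k l ∂μ) :
    IsUnitaryInvariant fun i j k l => ∫ ω, M ω i j * M ω k l ∂μ := by
  intro V hV i j k l
  beta_reduce
  rw [← hinv V hV i j k l]
  have h : ∀ ω, (star V * M ω * V) i j * (star V * M ω * V) k l =
      ∑ a, ∑ b, ∑ c, ∑ e, star (V a i) * V b j * (star (V c k) * V e l) *
        (M ω a b * M ω c e) := by
    intro ω
    simp only [conj_apply, Finset.sum_mul]
    simp only [Finset.mul_sum]
    refine Finset.sum_congr rfl fun a _ => Finset.sum_congr rfl fun b _ =>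
      Finset.sum_congr rfl fun c _ => Finset.sum_congr rfl fun e _ => by ring
  have hi : ∀ a b c e, Integrable (fun ω => star (V a i) * V b j * (star (V c k) * V e l) *
        (M ω a b * M ω c e)) μ := fun a b c e => (hint a b c e).const_mul _
  simp only [h]
  rw [integral_sum₄ hi]
  simp only [integral_const_mul]

lemma natCast_ne_zero_and_sub_add_one_ne_zero (hd : 2 ≤ d) :
    (d : ℂ) ≠ 0 ∧ (d : ℂ) - 1 ≠ 0 ∧ (d : ℂ) + 1 ≠ 0 := by
  refine ⟨by exact_mod_cast (by omega : d ≠ 0), sub_ne_zero.2 ?_, by exact_mod_cast d.succ_ne_zero⟩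
  exact_mod_cast (by omega : d ≠ 1)

/-- The second moments of a unitarily invariant random matrix whose trace and whose square's trace
are constant. The two coefficients are determined by contracting the indices in the two possible
ways. -/
theorem integral_mul_entries [IsProbabilityMeasure μ] (hd : 2 ≤ d)
    (hint : ∀ i j k l, Integrable (fun ω => M ω i j * M ω k l) μ)
    (hinv : ∀ V ∈ Matrix.unitaryGroup (Fin d) ℂ, ∀ i j k l,
      ∫ ω, (star V * M ω * V) i j * (star V * M ω * V) k l ∂μ = ∫ ω, M ω i j * M ω k l ∂μ)
    {t₁ t₂ : ℂ} (ht₁ : ∀ ω, (M ω).trace = t₁) (ht₂ : ∀ ω, (M ω ^ 2).trace = t₂)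
    (i j k l : Fin d) :
    ∫ ω, M ω i j * M ω k l ∂μ = identityCoeff d t₁ t₂ * (if i = j ∧ k = l then 1 else 0) +
      flipCoeff d t₁ t₂ * (if i = l ∧ k = j then 1 else 0) := by
  have : Nontrivial (Fin d) := Fin.nontrivial_iff_two_le.2 hd
  obtain ⟨α, β, h⟩ := (isUnitaryInvariant_secondMoment hint hinv).exists_eq
  have e1 : t₁ ^ 2 = α * d ^ 2 + β * d := by
    calc t₁ ^ 2 = ∫ ω, ∑ i, ∑ k, M ω i i * M ω k k ∂μ := by
          have : ∀ ω, ∑ i, ∑ k, M ω i i * M ω k k = t₁ ^ 2 := fun ω => by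
            rw [← ht₁ ω, sq, Matrix.trace, Finset.sum_mul_sum]; rfl
          simp [this]
      _ = ∑ i, ∑ k, ∫ ω, M ω i i * M ω k k ∂μ := by
          rw [integral_finsetSum _ fun i _ => integrable_finsetSum _ fun k _ => hint i i k k]
          exact Finset.sum_congr rfl fun i _ => integral_finsetSum _ fun k _ => hint i i k k
      _ = _ := by
          simp only [h]
          simp [Finset.sum_add_distrib, eq_comm]
          ring
  have e2 : t₂ = α * d + β * d ^ 2 := by
    calc t₂ = ∫ ω, ∑ i, ∑ k, M ω i k * M ω k i ∂μ := by
          have : ∀ ω, ∑ i, ∑ k, M ω i k * M ω k i = t₂ := fun ω => by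
            rw [← ht₂ ω, sq, Matrix.trace]; simp [Matrix.mul_apply]
          simp [this]
      _ = ∑ i, ∑ k, ∫ ω, M ω i k * M ω k i ∂μ := by
          rw [integral_finsetSum _ fun i _ => integrable_finsetSum _ fun k _ => hint i k k i]
          exact Finset.sum_congr rfl fun i _ => integral_finsetSum _ fun k _ => hint i k k i
      _ = _ := by
          simp only [h]
          simp [Finset.sum_add_distrib, eq_comm]
          ring
  obtain ⟨h0, h1, h2⟩ := natCast_ne_zero_and_sub_add_one_ne_zero hd
  have h3 : (d : ℂ) ^ 2 - 1 ≠ 0 := by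
    rw [show (d : ℂ) ^ 2 - 1 = (d - 1) * (d + 1) by ring]; exact mul_ne_zero h1 h2
  have hα : identityCoeff d t₁ t₂ = α := by
    rw [identityCoeff, div_eq_iff (mul_ne_zero h0 h3), e1, e2]; ring
  have hβ : flipCoeff d t₁ t₂ = β := by
    rw [flipCoeff, div_eq_iff (mul_ne_zero h0 h3), e1, e2]; ring
  rw [hα, hβ]
  exact h i j k l

/-- Contraction of the two invariant tensors with an arbitrary tensor. -/
lemma sum_delta_mul {α β : ℂ} (C : Fin d → Fin d → Fin d → Fin d → ℂ) :
    ∑ i, ∑ j, ∑ k, ∑ l, (α * (if i = j ∧ k = l then 1 else 0) +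
      β * (if i = l ∧ k = j then 1 else 0)) * C i j k l =
    α * ∑ i, ∑ k, C i i k k + β * ∑ i, ∑ k, C i k k i := by
  simp only [add_mul, mul_assoc, Finset.sum_add_distrib, ← Finset.mul_sum]
  congr 2 <;> refine Finset.sum_congr rfl fun i _ => ?_
  · rw [Finset.sum_eq_single i (fun j _ hj => by simp [hj.symm]) (by simp)]
    exact Finset.sum_congr rfl fun k _ => by simp
  · refine Finset.sum_congr rfl fun j _ => ?_
    rw [Finset.sum_eq_single j (fun k _ hk => by simp [hk]) (by simp)]
    simp

theorem integral_trace_mul_trace {α β : ℂ}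
    (hint : ∀ i j k l, Integrable (fun ω => M ω i j * M ω k l) μ)
    (hM : ∀ i j k l, ∫ ω, M ω i j * M ω k l ∂μ =
      α * (if i = j ∧ k = l then 1 else 0) + β * (if i = l ∧ k = j then 1 else 0))
    (A B : Matrix (Fin d) (Fin d) ℂ) :
    ∫ ω, (M ω * A).trace * (M ω * B).trace ∂μ = α * (A.trace * B.trace) + β * (A * B).trace := by
  have h : ∀ ω, (M ω * A).trace * (M ω * B).trace =
      ∑ i, ∑ j, ∑ k, ∑ l, M ω i j * M ω k l * (A j i * B l k) := fun ω => by
    simp only [Matrix.trace, Matrix.diag_apply, Matrix.mul_apply, Finset.sum_mul]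
    simp only [Finset.mul_sum]
    exact Finset.sum_congr rfl fun i _ => Finset.sum_congr rfl fun j _ =>
      Finset.sum_congr rfl fun k _ => Finset.sum_congr rfl fun l _ => by ring
  simp only [h]
  rw [integral_sum₄ fun i j k l => (hint i j k l).mul_const _]
  simp only [integral_mul_const, hM]
  rw [sum_delta_mul, Matrix.trace, Matrix.trace, Finset.sum_mul_sum, Finset.sum_comm (γ := Fin d)
    (f := fun i k => A k i * B i k)]
  simp [Matrix.trace, Matrix.mul_apply]

theorem integral_trace_mul_mul_mul {α β : ℂ}
    (hint : ∀ i j k l, Integrable (fun ω => M ω i j * M ω k l) μ)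
    (hM : ∀ i j k l, ∫ ω, M ω i j * M ω k l ∂μ =
      α * (if i = j ∧ k = l then 1 else 0) + β * (if i = l ∧ k = j then 1 else 0))
    (A B : Matrix (Fin d) (Fin d) ℂ) :
    ∫ ω, (M ω * A * (M ω * B)).trace ∂μ = α * (A * B).trace + β * (A.trace * B.trace) := by
  have h : ∀ ω, (M ω * A * (M ω * B)).trace =
      ∑ i, ∑ j, ∑ k, ∑ l, M ω i j * M ω k l * (A j k * B l i) := fun ω => by
    simp only [Matrix.trace, Matrix.diag_apply, Matrix.mul_apply, Finset.sum_mul]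
    simp only [Finset.mul_sum]
    refine Finset.sum_congr rfl fun i _ => Finset.sum_comm.trans <|
      Finset.sum_congr rfl fun j _ =>
      Finset.sum_congr rfl fun k _ => Finset.sum_congr rfl fun l _ => by ring
  simp only [h]
  rw [integral_sum₄ fun i j k l => (hint i j k l).mul_const _]
  simp only [integral_mul_const, hM]
  rw [sum_delta_mul, Matrix.trace, Matrix.trace, Matrix.trace, Finset.sum_mul_sum,
    Finset.sum_comm (γ := Fin d) (f := fun i k => A k k * B i i)]
  simp [Matrix.mul_apply]

end SecondMoments

/-! ### The Haar measure on the unitary group -/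

section Haar

variable {d : ℕ}

instance isHaarMeasure_haarUnitary : (haarUnitary d).IsHaarMeasure := by
  unfold haarUnitary; infer_instance

/-- A compact group is unimodular: a right translate of the normalized Haar measure is again a Haar
probability measure, hence the same one. -/
instance isMulRightInvariant_haarUnitary : (haarUnitary d).IsMulRightInvariant where
  map_mul_right_eq_self g := by
    have : IsProbabilityMeasure (Measure.map (· * g) (haarUnitary d)) :=
      Measure.isProbabilityMeasure_map (measurable_mul_const g).aemeasurable
    exact Measure.isHaarMeasure_eq_of_isProbabilityMeasure _ _

instance secondCountableTopology_unitaryGrp : SecondCountableTopology (UnitaryGrp d) :=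
  have : SecondCountableTopology (Matrix (Fin d) (Fin d) ℂ) :=
    inferInstanceAs (SecondCountableTopology (Fin d → Fin d → ℂ))
  TopologicalSpace.Subtype.secondCountableTopology _

end Haar

/-! ### Second moments of Haar random unitaries -/

section HaarMoments

variable {d : ℕ}

lemma continuous_coe_unitaryGrp :
    Continuous fun U : UnitaryGrp d => (U : Matrix (Fin d) (Fin d) ℂ) := continuous_subtype_val

lemma continuous_conj_left (K : Matrix (Fin d) (Fin d) ℂ) : Continuous fun U : UnitaryGrp d =>
    (U : Matrix (Fin d) (Fin d) ℂ) * K * star (U : Matrix (Fin d) (Fin d) ℂ) :=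
  (continuous_coe_unitaryGrp.matrix_mul continuous_const).matrix_mul
    continuous_coe_unitaryGrp.matrix_conjTranspose

lemma continuous_conj_right (K : Matrix (Fin d) (Fin d) ℂ) : Continuous fun U : UnitaryGrp d =>
    star (U : Matrix (Fin d) (Fin d) ℂ) * K * (U : Matrix (Fin d) (Fin d) ℂ) :=
  (continuous_coe_unitaryGrp.matrix_conjTranspose.matrix_mul continuous_const).matrix_mul
    continuous_coe_unitaryGrp

lemma integrable_entry_mul_entry {M : UnitaryGrp d → Matrix (Fin d) (Fin d) ℂ}
    (hM : Continuous M) (i j k l : Fin d) :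
    Integrable (fun U => M U i j * M U k l) (haarUnitary d) :=
  ((hM.matrix_elem i j).mul (hM.matrix_elem k l)).integrable_of_hasCompactSupport
    (HasCompactSupport.of_compactSpace _)

lemma trace_conj_right (K : Matrix (Fin d) (Fin d) ℂ) (U : UnitaryGrp d) :
    (star (U : Matrix (Fin d) (Fin d) ℂ) * K * U).trace = K.trace := by
  rw [Matrix.mul_assoc, Matrix.trace_mul_comm, Matrix.mul_assoc, Unitary.mul_star_self_of_mem U.2,
    Matrix.mul_one]

lemma sq_conj_right (K : Matrix (Fin d) (Fin d) ℂ) (U : UnitaryGrp d) :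
    (star (U : Matrix (Fin d) (Fin d) ℂ) * K * U) ^ 2 =
      star (U : Matrix (Fin d) (Fin d) ℂ) * K ^ 2 * U := by
  simp only [sq, Matrix.mul_assoc]
  rw [← Matrix.mul_assoc (U : Matrix (Fin d) (Fin d) ℂ) (star _),
    Unitary.mul_star_self_of_mem U.2, Matrix.one_mul]

/-- The second moments of `U† K U`; right invariance of the Haar measure makes this random matrix
unitarily invariant. -/
lemma haar_conj_right (hd : 2 ≤ d) (K : Matrix (Fin d) (Fin d) ℂ) (i j k l : Fin d) :
    ∫ U : UnitaryGrp d, (star (U : Matrix (Fin d) (Fin d) ℂ) * K * U) i j *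
        (star (U : Matrix (Fin d) (Fin d) ℂ) * K * U) k l ∂haarUnitary d =
      identityCoeff d K.trace (K ^ 2).trace * (if i = j ∧ k = l then 1 else 0) +
        flipCoeff d K.trace (K ^ 2).trace * (if i = l ∧ k = j then 1 else 0) := by
  refine integral_mul_entries (M := fun U : UnitaryGrp d =>
    star (U : Matrix (Fin d) (Fin d) ℂ) * K * (U : Matrix (Fin d) (Fin d) ℂ)) hd
    (integrable_entry_mul_entry (continuous_conj_right K)) ?_ (trace_conj_right K) ?_ i j k l
  · intro V hV i j k l
    rw [← integral_mul_right_eq_self (fun U : UnitaryGrp d =>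
      (star (U : Matrix (Fin d) (Fin d) ℂ) * K * U) i j *
        (star (U : Matrix (Fin d) (Fin d) ℂ) * K * U) k l) (⟨V, hV⟩ : UnitaryGrp d)]
    simp only [Submonoid.coe_mul, star_mul, Matrix.mul_assoc]
  · intro U
    rw [sq_conj_right, trace_conj_right]

/-- The second moments of `U K U†`; left invariance of the Haar measure makes this random matrix
unitarily invariant. -/
lemma haar_conj_left (hd : 2 ≤ d) (K : Matrix (Fin d) (Fin d) ℂ) (i j k l : Fin d) :
    ∫ U : UnitaryGrp d, ((U : Matrix (Fin d) (Fin d) ℂ) * K *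
          star (U : Matrix (Fin d) (Fin d) ℂ)) i j *
        ((U : Matrix (Fin d) (Fin d) ℂ) * K * star (U : Matrix (Fin d) (Fin d) ℂ)) k l
          ∂haarUnitary d =
      identityCoeff d K.trace (K ^ 2).trace * (if i = j ∧ k = l then 1 else 0) +
        flipCoeff d K.trace (K ^ 2).trace * (if i = l ∧ k = j then 1 else 0) := by
  have hstar : ∀ U : UnitaryGrp d, (U : Matrix (Fin d) (Fin d) ℂ) * K *
      star (U : Matrix (Fin d) (Fin d) ℂ) = star ((U⁻¹ : UnitaryGrp d) : Matrix (Fin d) (Fin d) ℂ)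
        * K * ((U⁻¹ : UnitaryGrp d) : Matrix (Fin d) (Fin d) ℂ) := fun U => by
    rw [Matrix.UnitaryGroup.inv_val, star_star]
  refine integral_mul_entries (M := fun U : UnitaryGrp d =>
    (U : Matrix (Fin d) (Fin d) ℂ) * K * star (U : Matrix (Fin d) (Fin d) ℂ)) hd
    (integrable_entry_mul_entry (continuous_conj_left K)) ?_ (fun U => ?_) (fun U => ?_) i j k l
  · intro V hV i j k l
    rw [← integral_mul_left_eq_self (fun U : UnitaryGrp d =>
      ((U : Matrix (Fin d) (Fin d) ℂ) * K * star (U : Matrix (Fin d) (Fin d) ℂ)) i j *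
        ((U : Matrix (Fin d) (Fin d) ℂ) * K * star (U : Matrix (Fin d) (Fin d) ℂ)) k l)
      (⟨V, hV⟩⁻¹ : UnitaryGrp d)]
    simp only [Submonoid.coe_mul, star_mul, Matrix.mul_assoc, Matrix.UnitaryGroup.inv_val,
      star_star]
  · rw [hstar, trace_conj_right]
  · rw [hstar, sq_conj_right, trace_conj_right]

/-- The pair of unitaries of a single ensemble member has the law of two independent Haar
unitaries. -/
lemma measurePreserving_member {N : ℕ} (n : Fin N) :
    MeasurePreserving (fun ω : (Fin N → UnitaryGrp d) × (Fin N → UnitaryGrp d) => (ω.1 n, ω.2 n))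
      (samplingLaw d N) ((haarUnitary d).prod (haarUnitary d)) :=
  (measurePreserving_eval (fun _ => haarUnitary d) n).prod
    (measurePreserving_eval (fun _ => haarUnitary d) n)

end HaarMoments

/-! ### The tangent kernel of the ensemble model -/

section Model

variable {d : ℕ} [NeZero d]

/-- The expectation as the trace of the random pure state `U|0⟩⟨0|U†` against the evolved
observable. -/
lemma expectation_state {H : Matrix (Fin d) (Fin d) ℂ} (hH : H.IsHermitian)
    (U S W : UnitaryGrp d) :
    ((expectation H (state U S W) : ℝ) : ℂ) =
      (((U : Matrix (Fin d) (Fin d) ℂ) * Matrix.single 0 0 1 *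
          star (U : Matrix (Fin d) (Fin d) ℂ)) *
        (star (S : Matrix (Fin d) (Fin d) ℂ) *
          (star (W : Matrix (Fin d) (Fin d) ℂ) * H * (W : Matrix (Fin d) (Fin d) ℂ)) *
            (S : Matrix (Fin d) (Fin d) ℂ))).trace := by
  have h1 : dotProduct (star (state U S W)) (H.mulVec (state U S W)) =
      (star ((W : Matrix (Fin d) (Fin d) ℂ) * S * U) * H * (W * S * U)) 0 0 := by
    rw [state]
    generalize (W : Matrix (Fin d) (Fin d) ℂ) * S * U = A
    rw [Matrix.star_mulVec, ← Matrix.dotProduct_mulVec, Matrix.mulVec_mulVec,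
      Matrix.mulVec_mulVec, ket0]
    simp [Matrix.star_eq_conjTranspose]
  have h2 : (star (dotProduct (star (state U S W)) (H.mulVec (state U S W)))) =
      dotProduct (star (state U S W)) (H.mulVec (state U S W)) := by
    rw [← Matrix.star_dotProduct, Matrix.star_mulVec, hH.eq, ← Matrix.dotProduct_mulVec]
  -- the quadratic form of a Hermitian matrix is real, so taking its real part loses nothing
  rw [expectation, Complex.conj_eq_iff_re.1 h2, h1]
  have h3 : ((U : Matrix (Fin d) (Fin d) ℂ) * Matrix.single 0 0 1 *
          star (U : Matrix (Fin d) (Fin d) ℂ)) *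
        (star (S : Matrix (Fin d) (Fin d) ℂ) *
          (star (W : Matrix (Fin d) (Fin d) ℂ) * H * (W : Matrix (Fin d) (Fin d) ℂ)) *
            (S : Matrix (Fin d) (Fin d) ℂ)) =
      (U : Matrix (Fin d) (Fin d) ℂ) * (Matrix.single 0 0 1 * (star (U : Matrix (Fin d) (Fin d) ℂ) *
        (star (S : Matrix (Fin d) (Fin d) ℂ) *
          (star (W : Matrix (Fin d) (Fin d) ℂ) * H * (W : Matrix (Fin d) (Fin d) ℂ)) *
            (S : Matrix (Fin d) (Fin d) ℂ)))) := by
    simp only [Matrix.mul_assoc]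
  rw [h3, Matrix.trace_mul_comm, Matrix.mul_assoc (Matrix.single _ _ _), Matrix.trace_single_mul,
    one_smul]
  simp only [star_mul, Matrix.mul_assoc]

variable {N : ℕ} {X : Type*}

/-- The model is linear in the parameter, so that its gradient is the vector of coefficients. -/
lemma hasGradientAt_ensembleModel (H : Matrix (Fin d) (Fin d) ℂ) (S : X → UnitaryGrp d)
    (U W : Fin N → UnitaryGrp d) (a : EuclideanSpace ℝ (Fin N)) (x : X) :
    HasGradientAt (fun t => ensembleModel H S U W t x)
      (WithLp.toLp 2 fun n => Real.sqrt d / Real.sqrt N * expectation H (state (U n) (S x) (W n)))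
      a := by
  have h : (fun t => ensembleModel H S U W t x) = InnerProductSpace.toDual ℝ _
      (WithLp.toLp 2 fun n =>
        Real.sqrt d / Real.sqrt N * expectation H (state (U n) (S x) (W n))) := by
    ext t
    simp only [ensembleModel, InnerProductSpace.toDual_apply_apply, PiLp.inner_apply,
      Finset.mul_sum]
    exact Finset.sum_congr rfl fun n _ => by simp; ring
  rw [h]
  exact ContinuousLinearMap.hasFDerivAt _

/-- The contribution of one ensemble member to the tangent kernel, up to the factor `d / N`. -/
def memberKernel (H : Matrix (Fin d) (Fin d) ℂ) (S S' : UnitaryGrp d)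
    (p : UnitaryGrp d × UnitaryGrp d) : ℝ :=
  expectation H (state p.1 S p.2) * expectation H (state p.1 S' p.2)

lemma ensembleKernel_eq (H : Matrix (Fin d) (Fin d) ℂ) (S : X → UnitaryGrp d)
    (a : EuclideanSpace ℝ (Fin N)) (x x' : X)
    (ω : (Fin N → UnitaryGrp d) × (Fin N → UnitaryGrp d)) :
    ensembleKernel H S a x x' ω =
      (d : ℝ) / N * ∑ n, memberKernel H (S x) (S x') (ω.1 n, ω.2 n) := by
  rw [ensembleKernel, tangentKernel, (hasGradientAt_ensembleModel H S ω.1 ω.2 a x).gradient,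
    (hasGradientAt_ensembleModel H S ω.1 ω.2 a x').gradient]
  simp only [PiLp.inner_apply, Finset.mul_sum]
  refine Finset.sum_congr rfl fun n _ => ?_
  have h : (Real.sqrt d / Real.sqrt N) ^ 2 = (d : ℝ) / N := by
    rw [div_pow, Real.sq_sqrt (Nat.cast_nonneg _), Real.sq_sqrt (Nat.cast_nonneg _)]
  rw [← h, memberKernel]
  simp
  ring

lemma continuous_expectation_state (H : Matrix (Fin d) (Fin d) ℂ) (S : UnitaryGrp d) :
    Continuous fun p : UnitaryGrp d × UnitaryGrp d => expectation H (state p.1 S p.2) := by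
  have h : Continuous fun p : UnitaryGrp d × UnitaryGrp d => state p.1 S p.2 :=
    (((continuous_coe_unitaryGrp.comp continuous_snd).matrix_mul continuous_const).matrix_mul
      (continuous_coe_unitaryGrp.comp continuous_fst)).matrix_mulVec continuous_const
  exact Complex.continuous_re.comp
    (h.star.dotProduct (continuous_const.matrix_mulVec h))

lemma continuous_memberKernel (H : Matrix (Fin d) (Fin d) ℂ) (S S' : UnitaryGrp d) :
    Continuous (memberKernel H S S') :=
  (continuous_expectation_state H S).mul (continuous_expectation_state H S')

lemma integrable_memberKernel (H : Matrix (Fin d) (Fin d) ℂ) (S S' : UnitaryGrp d) :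
    Integrable (memberKernel H S S') ((haarUnitary d).prod (haarUnitary d)) :=
  (continuous_memberKernel H S S').integrable_of_hasCompactSupport
    (HasCompactSupport.of_compactSpace _)

theorem integrable_ensembleKernel (H : Matrix (Fin d) (Fin d) ℂ) (S : X → UnitaryGrp d)
    (a : EuclideanSpace ℝ (Fin N)) (x x' : X) :
    Integrable (ensembleKernel H S a x x') (samplingLaw d N) := by
  simp only [funext (ensembleKernel_eq H S a x x')]
  exact (integrable_finsetSum _ fun n _ =>
    (measurePreserving_member n).integrable_comp_of_integrable (integrable_memberKernel H (S x) (S x'))).const_mul _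

theorem expectedKernel_eq_integral_memberKernel (hN : 1 ≤ N) (H : Matrix (Fin d) (Fin d) ℂ)
    (S : X → UnitaryGrp d) (a : EuclideanSpace ℝ (Fin N)) (x x' : X) :
    expectedKernel H S a x x' =
      d * ∫ p, memberKernel H (S x) (S x') p ∂(haarUnitary d).prod (haarUnitary d) := by
  have hint : ∀ n : Fin N, ∫ ω, memberKernel H (S x) (S x') (ω.1 n, ω.2 n) ∂samplingLaw d N =
      ∫ p, memberKernel H (S x) (S x') p ∂(haarUnitary d).prod (haarUnitary d) := fun n => by
    rw [← (measurePreserving_member n).map_eq, integral_map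
      (measurePreserving_member n).measurable.aemeasurable
      (continuous_memberKernel H (S x) (S x')).aestronglyMeasurable]
  have hi : ∀ n : Fin N, Integrable (fun ω : (Fin N → UnitaryGrp d) × (Fin N → UnitaryGrp d) =>
      memberKernel H (S x) (S x') (ω.1 n, ω.2 n)) (samplingLaw d N) := fun n =>
    (measurePreserving_member n).integrable_comp_of_integrable
      (integrable_memberKernel H (S x) (S x'))
  have hN' : (N : ℝ) ≠ 0 := by exact_mod_cast (by omega : N ≠ 0)
  simp only [expectedKernel, ensembleKernel_eq]
  rw [integral_const_mul, integral_finsetSum _ fun n _ => hi n]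
  simp only [hint, Finset.sum_const, Finset.card_univ, Fintype.card_fin, nsmul_eq_mul]
  field_simp

/-- Averaging over `U` replaces `U|0⟩⟨0|U†` by the second moments of a random pure state;
averaging over `W` then leaves a function of the overlap. -/
theorem integral_memberKernel (hd : 2 ≤ d) {H : Matrix (Fin d) (Fin d) ℂ} (hH : H.IsHermitian)
    (S S' : UnitaryGrp d) :
    ((∫ p, memberKernel H S S' p ∂(haarUnitary d).prod (haarUnitary d) : ℝ) : ℂ) =
      identityCoeff d 1 1 * H.trace ^ 2 + flipCoeff d 1 1 *
        (identityCoeff d H.trace (H ^ 2).trace * d + flipCoeff d H.trace (H ^ 2).trace *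
          ((‖((S' : Matrix (Fin d) (Fin d) ℂ) *
            (S : Matrix (Fin d) (Fin d) ℂ).conjTranspose).trace‖ ^ 2 : ℝ) : ℂ)) := by
  rw [← integral_complex_ofReal, integral_prod_symm _ (integrable_memberKernel H S S').ofReal]
  have hP : (Matrix.single (0 : Fin d) 0 (1 : ℂ)).trace = 1 := by simp
  have hP2 : (Matrix.single (0 : Fin d) 0 (1 : ℂ) ^ 2).trace = 1 := by simp [sq]
  have hU : ∀ W : UnitaryGrp d, ∫ U, ((memberKernel H S S' (U, W) : ℝ) : ℂ) ∂haarUnitary d =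
      identityCoeff d 1 1 * H.trace ^ 2 + flipCoeff d 1 1 *
        ((star (W : Matrix (Fin d) (Fin d) ℂ) * H * W) * (S * star (S' : Matrix (Fin d) (Fin d) ℂ))
          * ((star (W : Matrix (Fin d) (Fin d) ℂ) * H * W) *
            (S' * star (S : Matrix (Fin d) (Fin d) ℂ)))).trace := fun W => by
    simp only [memberKernel, Complex.ofReal_mul, expectation_state hH]
    have ht : ((star (S : Matrix (Fin d) (Fin d) ℂ) *
          (star (W : Matrix (Fin d) (Fin d) ℂ) * H * W) * S) *
        (star (S' : Matrix (Fin d) (Fin d) ℂ) *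
          (star (W : Matrix (Fin d) (Fin d) ℂ) * H * W) * S')).trace =
        ((star (W : Matrix (Fin d) (Fin d) ℂ) * H * W) * (S * star (S' : Matrix (Fin d) (Fin d) ℂ))
          * ((star (W : Matrix (Fin d) (Fin d) ℂ) * H * W) *
            (S' * star (S : Matrix (Fin d) (Fin d) ℂ)))).trace := by
      simp only [Matrix.mul_assoc]
      rw [Matrix.trace_mul_comm]
      simp only [Matrix.mul_assoc]
    rw [integral_trace_mul_trace
        (integrable_entry_mul_entry (continuous_conj_left (Matrix.single (0 : Fin d) 0 (1 : ℂ))))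
        (haar_conj_left hd (Matrix.single (0 : Fin d) 0 (1 : ℂ))),
      hP, hP2, trace_conj_right, trace_conj_right, trace_conj_right, trace_conj_right, ← sq, ht]
  -- `T = S S'†` is unitary, and `Tr T · Tr T†` is the overlap
  have hT : (S * star (S' : Matrix (Fin d) (Fin d) ℂ) : Matrix (Fin d) (Fin d) ℂ) *
      (S' * star (S : Matrix (Fin d) (Fin d) ℂ)) = 1 := by
    rw [Matrix.mul_assoc, ← Matrix.mul_assoc (star _), Unitary.star_mul_self_of_mem S'.2,
      Matrix.one_mul, Unitary.mul_star_self_of_mem S.2]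
  have hs : (S * star (S' : Matrix (Fin d) (Fin d) ℂ) : Matrix (Fin d) (Fin d) ℂ).trace *
      ((S' : Matrix (Fin d) (Fin d) ℂ) * star (S : Matrix (Fin d) (Fin d) ℂ)).trace =
      ((‖((S' : Matrix (Fin d) (Fin d) ℂ) *
            (S : Matrix (Fin d) (Fin d) ℂ).conjTranspose).trace‖ ^ 2 : ℝ) : ℂ) := by
    have : (S * star (S' : Matrix (Fin d) (Fin d) ℂ) : Matrix (Fin d) (Fin d) ℂ) =
        ((S' : Matrix (Fin d) (Fin d) ℂ) *
          (S : Matrix (Fin d) (Fin d) ℂ).conjTranspose).conjTranspose := by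
      rw [Matrix.conjTranspose_mul, Matrix.conjTranspose_conjTranspose, Matrix.star_eq_conjTranspose]
    rw [this, Matrix.trace_conjTranspose, Matrix.star_eq_conjTranspose]
    simpa using Complex.conj_mul' _
  have hc : Continuous fun W : UnitaryGrp d =>
      ((star (W : Matrix (Fin d) (Fin d) ℂ) * H * W) * (S * star (S' : Matrix (Fin d) (Fin d) ℂ))
          * ((star (W : Matrix (Fin d) (Fin d) ℂ) * H * W) *
            (S' * star (S : Matrix (Fin d) (Fin d) ℂ)))).trace :=
    (((continuous_conj_right H).matrix_mul continuous_const).matrix_mul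
      ((continuous_conj_right H).matrix_mul continuous_const)).matrix_trace
  simp only [hU]
  rw [integral_add (integrable_const _) ((hc.integrable_of_hasCompactSupport
    (HasCompactSupport.of_compactSpace _)).const_mul _), integral_const_mul (flipCoeff d 1 1),
    integral_trace_mul_mul_mul (integrable_entry_mul_entry (continuous_conj_right H))
      (haar_conj_right hd H), hT, hs]
  simp

theorem expectedKernel_formula (hd : 2 ≤ d) (hN : 1 ≤ N) {H : Matrix (Fin d) (Fin d) ℂ}
    (hH : H.IsHermitian) (S : X → UnitaryGrp d) (a : EuclideanSpace ℝ (Fin N)) (x x' : X) :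
    ((expectedKernel H S a x x' : ℝ) : ℂ) =
      ((d : ℂ) ^ 3 + (d : ℂ) ^ 2 - d - (overlap S x x' : ℂ)) /
          ((d : ℂ) * ((d : ℂ) ^ 3 + (d : ℂ) ^ 2 - d - 1)) * H.trace ^ 2 +
        ((overlap S x x' : ℂ) - 1) / ((d : ℂ) ^ 3 + (d : ℂ) ^ 2 - d - 1) * (H ^ 2).trace := by
  obtain ⟨h0, h1, h2⟩ := natCast_ne_zero_and_sub_add_one_ne_zero hd
  rw [expectedKernel_eq_integral_memberKernel hN, Complex.ofReal_mul, integral_memberKernel hd hH,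
    ← overlap, identityCoeff, identityCoeff, flipCoeff, flipCoeff,
    show (d : ℂ) ^ 3 + (d : ℂ) ^ 2 - d - 1 = (d - 1) * (d + 1) ^ 2 by ring,
    show (d : ℂ) ^ 2 - 1 = (d - 1) * (d + 1) by ring, Complex.ofReal_natCast]
  field_simp
  ring

theorem expectedKernel_of_traceless (hd : 2 ≤ d) (hN : 1 ≤ N) {H : Matrix (Fin d) (Fin d) ℂ}
    (hH : H.IsHermitian) (h₁ : H.trace = 0) (h₂ : (H ^ 2).trace = d) (S : X → UnitaryGrp d)
    (a : EuclideanSpace ℝ (Fin N)) (x x' : X) :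
    expectedKernel H S a x x' =
      (d : ℝ) * (overlap S x x' - 1) / ((d : ℝ) ^ 3 + (d : ℝ) ^ 2 - d - 1) := by
  have h := expectedKernel_formula hd hN hH S a x x'
  rw [h₁, h₂] at h
  apply Complex.ofReal_injective
  rw [h]
  push_cast
  ring

end Model

/-! ### Pauli strings -/

section PauliStrings

lemma Pauli.star_matrix (P : Pauli) (i j : Fin 2) : star (P.matrix j i) = P.matrix i j := by
  cases P <;> fin_cases i <;> fin_cases j <;> simp [Pauli.matrix]

lemma Pauli.trace_matrix {P : Pauli} (hP : P ≠ Pauli.I) : ∑ i, P.matrix i i = 0 := by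
  cases P <;> simp_all [Pauli.matrix]

lemma Pauli.matrix_mul_self (P : Pauli) (i : Fin 2) :
    ∑ j, P.matrix i j * P.matrix j i = 1 := by
  cases P <;> fin_cases i <;> simp [Pauli.matrix]

variable {n : ℕ}

lemma isHermitian_pauliString (P : Fin n → Pauli) : (pauliString P).IsHermitian := by
  ext i j
  simp only [Matrix.conjTranspose_apply, pauliString, Matrix.of_apply, star_prod,
    Pauli.star_matrix]

lemma trace_pauliString {P : Fin n → Pauli} (hP : ∃ k, P k ≠ Pauli.I) :
    (pauliString P).trace = 0 := by
  obtain ⟨k, hk⟩ := hP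
  calc (pauliString P).trace = ∑ b : Fin n → Fin 2, ∏ k, (P k).matrix (b k) (b k) :=
        Equiv.sum_comp finFunctionFinEquiv.symm fun b => ∏ k, (P k).matrix (b k) (b k)
    _ = ∏ k, ∑ i, (P k).matrix i i := (Fintype.prod_sum fun k i => (P k).matrix i i).symm
    _ = 0 := Finset.prod_eq_zero (Finset.mem_univ k) (Pauli.trace_matrix hk)

lemma trace_sq_pauliString (P : Fin n → Pauli) :
    ((pauliString P) ^ 2).trace = ((2 ^ n : ℕ) : ℂ) := by
  have h : ∀ i, ((pauliString P) ^ 2) i i = 1 := fun i => by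
    set b := finFunctionFinEquiv.symm i with hb
    calc ((pauliString P) ^ 2) i i
        = ∑ j, pauliString P i j * pauliString P j i := by rw [sq, Matrix.mul_apply]
      _ = ∑ c : Fin n → Fin 2, ∏ k, (P k).matrix (b k) (c k) * (P k).matrix (c k) (b k) := by
          simp only [Finset.prod_mul_distrib]
          exact Equiv.sum_comp finFunctionFinEquiv.symm fun c =>
            (∏ k, (P k).matrix (b k) (c k)) * ∏ k, (P k).matrix (c k) (b k)
      _ = ∏ k, ∑ j, (P k).matrix (b k) j * (P k).matrix j (b k) :=
          (Fintype.prod_sum fun k j => (P k).matrix (b k) j * (P k).matrix j (b k)).symm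
      _ = 1 := Finset.prod_eq_one fun k _ => Pauli.matrix_mul_self _ _
  simp [Matrix.trace, h]

end PauliStrings

/-! ### The limit of infinite dimension -/

section Limit

/-- The factor `u` in `𝔼 K = u · s / d² - v`. -/
lemma tendsto_leading_factor :
    Tendsto (fun t : ℝ => t ^ 3 / (t ^ 3 + t ^ 2 - t - 1)) atTop (𝓝 1) := by
  have h : Tendsto (fun t : ℝ => (1 + t⁻¹ - t⁻¹ ^ 2 - t⁻¹ ^ 3)⁻¹) atTop (𝓝 1) := by
    have := ((((tendsto_inv_atTop_zero (𝕜 := ℝ)).const_add 1).sub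
      (tendsto_inv_atTop_zero.pow 2)).sub (tendsto_inv_atTop_zero.pow 3)).inv₀ (by norm_num)
    simpa using this
  refine h.congr' ?_
  filter_upwards [eventually_gt_atTop 0] with t ht
  rw [inv_eq_one_div, ← mul_div_mul_left _ _ (pow_ne_zero 3 ht.ne')]
  congr 1 <;> field_simp

/-- The offset `v` in `𝔼 K = u · s / d² - v`. -/
lemma tendsto_offset :
    Tendsto (fun t : ℝ => t / (t ^ 3 + t ^ 2 - t - 1)) atTop (𝓝 0) := by
  have h := tendsto_leading_factor.mul ((tendsto_inv_atTop_zero (𝕜 := ℝ)).pow 2)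
  refine (h.congr' ?_).trans (by simp)
  filter_upwards [eventually_gt_atTop 0] with t ht
  field_simp

/-- If `d → ∞`, the values `d (s - 1) / (d³ + d² - d - 1)` converge exactly when `s / d²` does,
and to the same limit. -/
lemma tendsto_kernel_iff {t s : ℕ → ℝ} (ht : Tendsto t atTop atTop) (c : ℝ) :
    Tendsto (fun m => t m * (s m - 1) / (t m ^ 3 + t m ^ 2 - t m - 1)) atTop (𝓝 c) ↔
      Tendsto (fun m => s m / t m ^ 2) atTop (𝓝 c) := by
  have hu := tendsto_leading_factor.comp ht
  have hv := tendsto_offset.comp ht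
  constructor
  · intro h
    have := (h.add hv).div hu one_ne_zero
    rw [add_zero, div_one] at this
    refine this.congr' ?_
    filter_upwards [ht.eventually_gt_atTop 1] with m hm
    have h0 : t m ≠ 0 := by positivity
    have hD : t m ^ 3 + t m ^ 2 - t m - 1 ≠ 0 := by
      rw [show t m ^ 3 + t m ^ 2 - t m - 1 = (t m - 1) * (t m + 1) ^ 2 by ring]
      have : 0 < t m - 1 := by linarith
      positivity
    simp only [Pi.div_apply, Function.comp]
    rw [← add_div, div_div_div_cancel_right₀ hD]
    field_simp
    ring
  · intro h
    have := (h.mul hu).sub hv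
    rw [mul_one, sub_zero] at this
    refine this.congr' ?_
    filter_upwards [ht.eventually_gt_atTop 1] with m hm
    have h0 : t m ≠ 0 := by positivity
    simp only [Function.comp]
    field_simp

end Limit

end QuantumEnsemble

theorem mainTheorem1 :
    -- the expected tangent kernel for an arbitrary observable
    (∀ (d : ℕ) [NeZero d], 2 ≤ d → ∀ (N : ℕ), 1 ≤ N →
      ∀ (H : Matrix (Fin d) (Fin d) ℂ), H.IsHermitian →
      ∀ (X : Type*) (S : X → QuantumEnsemble.UnitaryGrp d)
        (a : EuclideanSpace ℝ (Fin N)) (x x' : X),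
        Integrable (QuantumEnsemble.ensembleKernel H S a x x')
          (QuantumEnsemble.samplingLaw d N) ∧
        ((QuantumEnsemble.expectedKernel H S a x x' : ℝ) : ℂ) =
          ((d : ℂ) ^ 3 + (d : ℂ) ^ 2 - d - (QuantumEnsemble.overlap S x x' : ℂ)) /
              ((d : ℂ) * ((d : ℂ) ^ 3 + (d : ℂ) ^ 2 - d - 1)) * H.trace ^ 2 +
            ((QuantumEnsemble.overlap S x x' : ℂ) - 1) /
              ((d : ℂ) ^ 3 + (d : ℂ) ^ 2 - d - 1) * (H ^ 2).trace) ∧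
    -- observables with the traces of a Pauli observable
    (∀ (d : ℕ) [NeZero d], 2 ≤ d → ∀ (N : ℕ), 1 ≤ N →
      ∀ (H : Matrix (Fin d) (Fin d) ℂ), H.IsHermitian → H.trace = 0 → (H ^ 2).trace = d →
      ∀ (X : Type*) (S : X → QuantumEnsemble.UnitaryGrp d)
        (a : EuclideanSpace ℝ (Fin N)) (x x' : X),
        QuantumEnsemble.expectedKernel H S a x x' =
          (d : ℝ) * (QuantumEnsemble.overlap S x x' - 1) /
            ((d : ℝ) ^ 3 + (d : ℝ) ^ 2 - d - 1)) ∧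
    -- every Pauli string other than the identity has these traces
    (∀ (n : ℕ) (P : Fin n → QuantumEnsemble.Pauli), (∃ k, P k ≠ QuantumEnsemble.Pauli.I) →
      (QuantumEnsemble.pauliString P).IsHermitian ∧
      (QuantumEnsemble.pauliString P).trace = 0 ∧
      ((QuantumEnsemble.pauliString P) ^ 2).trace = ((2 ^ n : ℕ) : ℂ)) ∧
    -- the limit of infinite dimension
    (∀ (d : ℕ → ℕ) [∀ m, NeZero (d m)], Tendsto d atTop atTop →
      ∀ (N : ℕ → ℕ), (∀ m, 1 ≤ N m) →
      ∀ (H : ∀ m, Matrix (Fin (d m)) (Fin (d m)) ℂ), (∀ m, (H m).IsHermitian) →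
        (∀ m, (H m).trace = 0) → (∀ m, (H m ^ 2).trace = d m) →
      ∀ (X : ℕ → Type*) (S : ∀ m, X m → QuantumEnsemble.UnitaryGrp (d m))
        (a : ∀ m, EuclideanSpace ℝ (Fin (N m))) (x x' : ∀ m, X m),
        ((fun m => QuantumEnsemble.overlap (S m) (x m) (x' m)) ~[atTop]
            (fun m => (d m : ℝ) ^ 2) →
          Tendsto (fun m => QuantumEnsemble.expectedKernel (H m) (S m) (a m) (x m) (x' m))
            atTop (𝓝 1)) ∧
        ((fun m => QuantumEnsemble.overlap (S m) (x m) (x' m)) =o[atTop]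
            (fun m => (d m : ℝ) ^ 2) →
          Tendsto (fun m => QuantumEnsemble.expectedKernel (H m) (S m) (a m) (x m) (x' m))
            atTop (𝓝 0)) ∧
        ∀ c : ℝ,
          Tendsto (fun m => QuantumEnsemble.expectedKernel (H m) (S m) (a m) (x m) (x' m))
              atTop (𝓝 c) ↔
            Tendsto (fun m => QuantumEnsemble.overlap (S m) (x m) (x' m) / (d m : ℝ) ^ 2)
              atTop (𝓝 c)) := by
  refine ⟨fun d _ hd N hN H hH X S a x x' =>
      ⟨QuantumEnsemble.integrable_ensembleKernel H S a x x',
        QuantumEnsemble.expectedKernel_formula hd hN hH S a x x'⟩,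
    fun d _ hd N hN H hH h₁ h₂ X S a x x' =>
      QuantumEnsemble.expectedKernel_of_traceless hd hN hH h₁ h₂ S a x x',
    fun n P hP => ⟨QuantumEnsemble.isHermitian_pauliString P, QuantumEnsemble.trace_pauliString hP,
      QuantumEnsemble.trace_sq_pauliString P⟩, ?_⟩
  intro d _ hd N hN H hH h₁ h₂ X S a x x'
  have hd' : Tendsto (fun m => (d m : ℝ)) atTop atTop := tendsto_natCast_atTop_atTop.comp hd
  have key : ∀ c : ℝ,
      Tendsto (fun m => QuantumEnsemble.expectedKernel (H m) (S m) (a m) (x m) (x' m))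
          atTop (𝓝 c) ↔
        Tendsto (fun m => QuantumEnsemble.overlap (S m) (x m) (x' m) / (d m : ℝ) ^ 2)
          atTop (𝓝 c) := fun c => by
    rw [← QuantumEnsemble.tendsto_kernel_iff hd' c]
    refine tendsto_congr' ?_
    filter_upwards [hd.eventually_ge_atTop 2] with m hm
    exact QuantumEnsemble.expectedKernel_of_traceless hm (hN m) (hH m) (h₁ m) (h₂ m) _ _ _ _
  refine ⟨fun h => (key 1).2 ?_, fun h => (key 0).2 h.tendsto_div_nhds_zero, key⟩
  refine (isEquivalent_iff_tendsto_one ?_).1 h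
  exact Eventually.of_forall fun m => pow_ne_zero 2 (Nat.cast_ne_zero.2 (NeZero.ne (d m)))
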